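/- Theorem 1. Let $b$ be a positive integer and, for $0<t<1$, let $$f_b(t)=2\sum_{n=0}^{\infty}(-1)^n q^{n^2+bn},\qquad q=\frac{1-t}{1+t}.$$ Then there is a unique real sequence $(a_n)_{n\ge 0}$ such that $f_b(t)\sim\sum_{n\ge 0}a_nt^n$ as $t\to 0^+$, that is, such that for every integer $N\ge 0$, $f_b(t)-\sum_{n=0}^{N}a_nt^n=o(t^N)$ as $t\to 0^+$. The coefficients $a_n$ eventually all have the same strict sign (the Berndt–Kim conjecture): either $a_n>0$ for all sufficiently large $n$, or $a_n<0$ for all sufficiently large $n$. More precisely, if $b\equiv 1$ or $2\pmod 4$, then $a_n>0$ for all sufficiently large $n$, and if $b\equiv 0$ or $3\pmod 4$, then $a_n<0$ for all sufficiently large $n$. -/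

import Mathlib

open Filter Topology Asymptotics

/-- The partial theta function `f_b(t) = 2 ∑_{n ≥ 0} (-1)^n q^(n² + b n)` with
`q = (1 - t) / (1 + t)`. For `0 < t < 1` one has `0 < q < 1` and the series converges absolutely. -/
noncomputable def partialTheta (b : ℕ) (t : ℝ) : ℝ :=
  2 * ∑' n : ℕ, (-1 : ℝ) ^ n * ((1 - t) / (1 + t)) ^ (n ^ 2 + b * n)

/-- Absolute convergence of the defining series of `partialTheta` for `0 < t < 1`. -/
theorem summable_partialTheta (b : ℕ) {t : ℝ} (h0 : 0 < t) (h1 : t < 1) :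
    Summable fun n : ℕ => (-1 : ℝ) ^ n * ((1 - t) / (1 + t)) ^ (n ^ 2 + b * n) := by
  have hq0 : 0 ≤ (1 - t) / (1 + t) := div_nonneg (by linarith) (by linarith)
  have hq1 : (1 - t) / (1 + t) < 1 := by
    rw [div_lt_one (by linarith)]
    linarith
  refine Summable.of_norm_bounded (summable_geometric_of_lt_one hq0 hq1) fun n => ?_
  rw [norm_mul, norm_pow, norm_neg, norm_one, one_pow, one_mul, Real.norm_eq_abs,
    abs_of_nonneg (pow_nonneg hq0 _)]
  exact pow_le_pow_of_le_one hq0 hq1.le (by nlinarith [Nat.zero_le (b * n)])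

/-- `f(t) ∼ ∑_{n ≥ 0} a_n t^n` as `t → 0⁺`, in the sense of Poincaré: for every `N`,
`f(t) - ∑_{n ≤ N} a_n t^n = o(t^N)` as `t → 0⁺`. -/
def HasAsymptoticExpansion (f : ℝ → ℝ) (a : ℕ → ℝ) : Prop :=
  ∀ N : ℕ, (fun t : ℝ => f t - ∑ n ∈ Finset.range (N + 1), a n * t ^ n)
    =o[𝓝[>] (0 : ℝ)] fun t : ℝ => t ^ N

/-!
With `E = (1 + t) / (1 - t) = 1 / q`, shifting the summation index gives
`f_{b+2} = E ^ (b + 1) * (2 - f_b)`, so everything reduces to `b = 1` and `b = 2`. Completing the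
square turns `f_b` into `2 * exp (w b² / 4) * ∑ (-1)^n exp (-w (n + b/2)²)` with `w = log E`, an
alternating sum of Gaussian values, which Boole's summation formula (the formal inverse
`1 / cosh (δ D)` of the average of the translations by `±δ`) expands in powers of `w`. For `b = 2`
twice the sum is `1` to all orders, so `f_2 ∼ E`. For `b = 1`, the signs of the Taylor coefficients
of `1 / cosh √x` alternate and cancel those of the derivatives of the Gaussian at `0`, which makes
the coefficients of `f_1` at least `n! / 4^n`. In both cases, after multiplication by `E ^ k`, the
coefficients eventually exceed those of any constant multiple of `E ^ k`. The recurrence flips the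
sign and keeps this dominance, so the sign for `b` is that of `(-1) ^ ⌊(b - 1) / 2⌋`.
-/

open scoped Nat Polynomial PowerSeries SchwartzMap

section Expansions

/-- `f` has the formal power series `P` as asymptotic expansion at `0⁺`. Expansions are indexed by
power series rather than by coefficient sequences so that they can be multiplied and composed;
`hasAsymptoticExpansion_iff` compares this with `HasAsymptoticExpansion`. -/
def HasSeriesExpansion (f : ℝ → ℝ) (P : ℝ⟦X⟧) : Prop :=
  ∀ N : ℕ, (fun t => f t - (P.trunc N).eval t) =O[𝓝[>] (0 : ℝ)] fun t => t ^ N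

theorem eval_trunc_eq_sum {R : Type*} [CommSemiring R] (P : R⟦X⟧) (N : ℕ) (t : R) :
    (P.trunc N).eval t = ∑ n ∈ Finset.range N, P.coeff n * t ^ n := by
  simpa using PowerSeries.eval₂_trunc_eq_sum_range t (RingHom.id R) N P

theorem isBigO_eval_of_X_pow_dvd {p : ℝ[X]} {N : ℕ} (h : Polynomial.X ^ N ∣ p) :
    (fun t : ℝ => p.eval t) =O[𝓝[>] (0 : ℝ)] fun t => t ^ N := by
  obtain ⟨q, rfl⟩ := h
  have hq : (fun t : ℝ => q.eval t) =O[𝓝[>] (0 : ℝ)] fun _ => (1 : ℝ) :=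
    (q.continuous.continuousAt.isBigO_one ℝ).mono nhdsWithin_le_nhds
  simpa using (isBigO_refl (fun t : ℝ => t ^ N) (𝓝[>] 0)).mul hq

theorem X_pow_dvd_sub_trunc {R : Type*} [CommRing R] (P : R⟦X⟧) (N : ℕ) :
    (PowerSeries.X : R⟦X⟧) ^ N ∣ P - (P.trunc N : R⟦X⟧) := by
  rw [PowerSeries.X_pow_dvd_iff]
  intro n hn
  simp [PowerSeries.coeff_trunc, hn]

theorem hasAsymptoticExpansion_iff {f : ℝ → ℝ} {P : ℝ⟦X⟧} :
    HasAsymptoticExpansion f (fun n => P.coeff n) ↔ HasSeriesExpansion f P := by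
  simp only [HasAsymptoticExpansion, HasSeriesExpansion, eval_trunc_eq_sum]
  have hlt (N : ℕ) : (fun t : ℝ => t ^ (N + 1)) =o[𝓝[>] (0 : ℝ)] fun t => t ^ N :=
    (isLittleO_pow_pow N.lt_succ_self).mono nhdsWithin_le_nhds
  refine ⟨fun h N => ?_, fun h N => (h (N + 1)).trans_isLittleO (hlt N)⟩
  have hlast : (fun t : ℝ => P.coeff N * t ^ N) =O[𝓝[>] (0 : ℝ)] fun t => t ^ N :=
    (isBigO_refl _ _).const_mul_left _
  refine ((h N).isBigO.add hlast).congr_left fun t => ?_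
  rw [Finset.sum_range_succ]
  ring

theorem HasAsymptoticExpansion.unique {f : ℝ → ℝ} {a b : ℕ → ℝ}
    (ha : HasAsymptoticExpansion f a) (hb : HasAsymptoticExpansion f b) : a = b := by
  funext n
  induction n using Nat.strong_induction_on with
  | _ n ih =>
    have hdiff : (fun t : ℝ => (a n - b n) * t ^ n) =o[𝓝[>] (0 : ℝ)] fun t => t ^ n := by
      refine ((hb n).sub (ha n)).congr_left fun t => ?_
      have hlow : ∑ i ∈ Finset.range n, a i * t ^ i = ∑ i ∈ Finset.range n, b i * t ^ i :=
        Finset.sum_congr rfl fun i hi => by rw [ih i (Finset.mem_range.1 hi)]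
      rw [Finset.sum_range_succ, Finset.sum_range_succ, hlow]
      ring
    have hfreq : ∃ᶠ t in 𝓝[>] (0 : ℝ), t ^ n ≠ 0 :=
      Eventually.frequently <| by
        filter_upwards [self_mem_nhdsWithin] with t ht using pow_ne_zero n (Set.mem_Ioi.1 ht).ne'
    by_contra hne
    exact isLittleO_irrefl hfreq ((isLittleO_const_mul_left_iff (sub_ne_zero.2 hne)).1 hdiff)

namespace HasSeriesExpansion

variable {f g : ℝ → ℝ} {P Q : ℝ⟦X⟧}

theorem of_forall_exists (h : ∀ N : ℕ, ∃ p : ℝ[X], (PowerSeries.X : ℝ⟦X⟧) ^ N ∣ P - (p : ℝ⟦X⟧) ∧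
      (fun t => f t - p.eval t) =O[𝓝[>] (0 : ℝ)] fun t => t ^ N) :
    HasSeriesExpansion f P := fun N => by
  obtain ⟨p, hP, hf⟩ := h N
  have hdvd : Polynomial.X ^ N ∣ p - P.trunc N := by
    rw [Polynomial.X_pow_dvd_iff]
    intro n hn
    have hn' := PowerSeries.X_pow_dvd_iff.1 hP n hn
    rw [map_sub, Polynomial.coeff_coe, sub_eq_zero] at hn'
    rw [Polynomial.coeff_sub, PowerSeries.coeff_trunc, if_pos hn, hn', sub_self]
  refine (hf.add (isBigO_eval_of_X_pow_dvd hdvd)).congr_left fun t => ?_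
  rw [Polynomial.eval_sub]
  ring

theorem congr' (h : HasSeriesExpansion f P) (hfg : f =ᶠ[𝓝[>] 0] g) : HasSeriesExpansion g P :=
  fun N => (h N).congr' (by filter_upwards [hfg] with t ht; rw [ht]) .rfl

theorem add (hf : HasSeriesExpansion f P) (hg : HasSeriesExpansion g Q) :
    HasSeriesExpansion (fun t => f t + g t) (P + Q) := fun N =>
  ((hf N).add (hg N)).congr_left fun t => by
    rw [map_add, Polynomial.eval_add]
    ring

theorem sub (hf : HasSeriesExpansion f P) (hg : HasSeriesExpansion g Q) :
    HasSeriesExpansion (fun t => f t - g t) (P - Q) := fun N =>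
  ((hf N).sub (hg N)).congr_left fun t => by
    rw [PowerSeries.trunc_sub, Polynomial.eval_sub]
    ring

theorem const (c : ℝ) : HasSeriesExpansion (fun _ => c) (PowerSeries.C c) :=
  of_forall_exists fun N => ⟨Polynomial.C c, by simp, by simpa using isBigO_zero _ _⟩

theorem isBigO_one (hf : HasSeriesExpansion f P) :
    f =O[𝓝[>] (0 : ℝ)] fun _ => (1 : ℝ) := by
  simpa using hf 0

theorem mul (hf : HasSeriesExpansion f P) (hg : HasSeriesExpansion g Q) :
    HasSeriesExpansion (fun t => f t * g t) (P * Q) := by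
  refine of_forall_exists fun N => ⟨P.trunc N * Q.trunc N, ?_, ?_⟩
  · have h := (((X_pow_dvd_sub_trunc P N).mul_right Q).add
      ((X_pow_dvd_sub_trunc Q N).mul_left (P.trunc N : ℝ⟦X⟧)))
    convert h using 1
    rw [Polynomial.coe_mul]
    ring
  · have hq : (fun t => (Q.trunc N).eval t) =O[𝓝[>] (0 : ℝ)] fun _ => (1 : ℝ) :=
      ((Q.trunc N).continuous.continuousAt.isBigO_one ℝ).mono nhdsWithin_le_nhds
    have h := (hf.isBigO_one.mul (hg N)).add (((hf N).mul hq).congr_right fun t => mul_comm _ _)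
    simp only [one_mul] at h
    refine h.congr_left fun t => ?_
    rw [Polynomial.eval_mul]
    ring

theorem aeval (hf : HasSeriesExpansion f P) (p : ℝ[X]) :
    HasSeriesExpansion (fun t => p.eval (f t)) (Polynomial.aeval P p) := by
  induction p using Polynomial.induction_on with
  | C c => simpa [PowerSeries.algebraMap_apply] using const c
  | add p q hp hq => simpa using hp.add hq
  | monomial n c h => simpa [pow_succ, mul_assoc] using h.mul hf

theorem of_eventually_hasSum
    (h : ∀ᶠ t in 𝓝 (0 : ℝ), HasSum (fun n => P.coeff n * t ^ n) (f t)) :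
    HasSeriesExpansion f P := fun N => by
  have hps : HasFPowerSeriesAt f (FormalMultilinearSeries.ofScalars ℝ fun n => P.coeff n) 0 := by
    rw [hasFPowerSeriesAt_iff]
    filter_upwards [h] with t ht
    simpa [FormalMultilinearSeries.coeff_ofScalars, mul_comm] using ht
  have hO := (hps.isBigO_sub_partialSum_pow N).mono (nhdsWithin_le_nhds (s := Set.Ioi 0))
  refine (hO.congr_left fun t => ?_).trans (IsBigO.of_bound 1 ?_)
  · rw [zero_add, eval_trunc_eq_sum, FormalMultilinearSeries.partialSum]
    simp [mul_comm]
  · simp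

/-- Splitting `c` at degree `N` writes `c(W) = W ^ N * (…) + p(W)` with `p` a polynomial, and both
`W` and `w` are small. -/
theorem comp {F w : ℝ → ℝ} {c W : ℝ⟦X⟧} (hF : HasSeriesExpansion F c)
    (hw : HasSeriesExpansion w W) (hW : W.constantCoeff = 0)
    (hpos : ∀ᶠ t in 𝓝[>] (0 : ℝ), 0 < w t) :
    HasSeriesExpansion (fun t => F (w t)) (c.subst W) := by
  have hw1 : w =O[𝓝[>] (0 : ℝ)] fun t => t := by
    simpa [PowerSeries.trunc_one_left, hW] using hw 1
  have hlim : Tendsto w (𝓝[>] 0) (𝓝[>] 0) := tendsto_nhdsWithin_iff.2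
    ⟨hw1.trans_tendsto (tendsto_id.mono_left nhdsWithin_le_nhds), hpos⟩
  have hsubst := PowerSeries.HasSubst.of_constantCoeff_zero' hW
  refine of_forall_exists fun N =>
    ⟨((Polynomial.aeval W (c.trunc N)).trunc N), ?_, ?_⟩
  · obtain ⟨V, hV⟩ := X_pow_dvd_sub_trunc c N
    have hc : c.subst W = W ^ N * V.subst W + Polynomial.aeval W (c.trunc N) := by
      have hX : (PowerSeries.X ^ N : ℝ⟦X⟧).subst W = W ^ N := by
        rw [PowerSeries.subst_pow hsubst, PowerSeries.subst_X hsubst]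
      rw [← hX, ← PowerSeries.subst_mul hsubst, ← hV, ← PowerSeries.subst_coe hsubst,
        ← PowerSeries.subst_add hsubst, sub_add_cancel]
    rw [hc, add_sub_assoc]
    exact ((pow_dvd_pow_of_dvd (PowerSeries.X_dvd_iff.2 hW) N).mul_right _).add
      (X_pow_dvd_sub_trunc _ N)
  · refine (((hF N).comp_tendsto hlim).trans (hw1.pow N)).add (hw.aeval (c.trunc N) N)
      |>.congr_left fun t => ?_
    simp only [Function.comp_apply]
    ring

end HasSeriesExpansion

end Expansions

section CoefficientBounds

section Nonneg

variable {R : Type*} [CommSemiring R] [PartialOrder R] [IsOrderedRing R] {P Q : R⟦X⟧}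

theorem coeff_mul_nonneg (hP : ∀ n, 0 ≤ P.coeff n) (hQ : ∀ n, 0 ≤ Q.coeff n) (n : ℕ) :
    0 ≤ (P * Q).coeff n := by
  rw [PowerSeries.coeff_mul]
  exact Finset.sum_nonneg fun i _ => mul_nonneg (hP _) (hQ _)

theorem coeff_pow_nonneg (hP : ∀ n, 0 ≤ P.coeff n) (k n : ℕ) : 0 ≤ (P ^ k).coeff n := by
  induction k generalizing n with
  | zero =>
    rw [pow_zero, PowerSeries.coeff_one]
    split_ifs
    exacts [zero_le_one, le_rfl]
  | succ k ih =>
    rw [pow_succ]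
    exact coeff_mul_nonneg ih hP n

theorem coeff_le_coeff_mul (hP : ∀ n, 0 ≤ P.coeff n) (hP0 : 1 ≤ P.coeff 0)
    (hQ : ∀ n, 0 ≤ Q.coeff n) (n : ℕ) : Q.coeff n ≤ (P * Q).coeff n := by
  rw [PowerSeries.coeff_mul]
  calc Q.coeff n ≤ P.coeff 0 * Q.coeff n := le_mul_of_one_le_left (hQ n) hP0
    _ ≤ _ := Finset.single_le_sum (f := fun p : ℕ × ℕ => P.coeff p.1 * Q.coeff p.2)
      (fun i _ => mul_nonneg (hP _) (hQ _)) (by simp : ((0, n) : ℕ × ℕ) ∈ _)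

end Nonneg

section Abs

variable {R : Type*} [CommRing R] [LinearOrder R] [IsStrictOrderedRing R] {P Q : R⟦X⟧} {r s : R}

theorem abs_coeff_mul_le_pow (hP : ∀ n, |P.coeff n| ≤ r ^ n) (hQ : ∀ n, |Q.coeff n| ≤ s ^ n)
    (n : ℕ) : |(P * Q).coeff n| ≤ (r + s) ^ n := by
  have hr : 0 ≤ r := (abs_nonneg _).trans ((hP 1).trans_eq (pow_one r))
  have hs : 0 ≤ s := (abs_nonneg _).trans ((hQ 1).trans_eq (pow_one s))
  rw [PowerSeries.coeff_mul, (Commute.all r s).add_pow']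
  refine (Finset.abs_sum_le_sum_abs _ _).trans (Finset.sum_le_sum fun p hp => ?_)
  have hchoose : (1 : R) ≤ n.choose p.1 := by
    exact_mod_cast Nat.choose_pos (Finset.HasAntidiagonal.antidiagonal.fst_le hp)
  rw [abs_mul, nsmul_eq_mul]
  calc |P.coeff p.1| * |Q.coeff p.2| ≤ r ^ p.1 * s ^ p.2 :=
        mul_le_mul (hP _) (hQ _) (abs_nonneg _) (by positivity)
    _ ≤ n.choose p.1 * (r ^ p.1 * s ^ p.2) := le_mul_of_one_le_left (by positivity) hchoose

theorem abs_coeff_pow_le_pow (hP : ∀ n, |P.coeff n| ≤ r ^ n) (k n : ℕ) :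
    |(P ^ k).coeff n| ≤ (k * r) ^ n := by
  induction k generalizing n with
  | zero => rcases eq_or_ne n 0 with rfl | hn <;> simp [PowerSeries.coeff_one, *]
  | succ k ih =>
    rw [pow_succ, Nat.cast_succ, add_one_mul]
    exact abs_coeff_mul_le_pow ih hP n

end Abs

theorem coeff_mul_coeff_pow_le_coeff_subst {R : Type*} [CommRing R] [PartialOrder R]
    [IsOrderedRing R] {c W : R⟦X⟧} (hW : W.constantCoeff = 0)
    (hc : ∀ n, 0 ≤ c.coeff n) (hWn : ∀ n, 0 ≤ W.coeff n) (k n : ℕ) :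
    c.coeff k * (W ^ k).coeff n ≤ PowerSeries.coeff n (c.subst W) := by
  have hsubst := PowerSeries.HasSubst.of_constantCoeff_zero' hW
  rw [PowerSeries.coeff_subst' hsubst]
  exact single_le_finsum k (PowerSeries.coeff_subst_finite' hsubst c n)
    fun j => mul_nonneg (hc j) (coeff_pow_nonneg hWn j n)

end CoefficientBounds

section CayleySeries

/-- The power series `1 + 2 X + 2 X² + ⋯` of `(1 + t) / (1 - t)`, the reciprocal of the nome `q` of
`partialTheta`. -/
noncomputable def cayleySeries : ℝ⟦X⟧ := PowerSeries.mk fun n => if n = 0 then 1 else 2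

theorem cayleySeries_mul_one_sub_X : cayleySeries * (1 - PowerSeries.X) = 1 + PowerSeries.X := by
  ext n
  rcases n with _ | _ | n <;>
    norm_num [cayleySeries, mul_sub, PowerSeries.coeff_succ_mul_X, PowerSeries.coeff_X,
      PowerSeries.coeff_one]

theorem hasSeriesExpansion_cayley :
    HasSeriesExpansion (fun t => (1 + t) / (1 - t)) cayleySeries := by
  refine .of_eventually_hasSum ?_
  filter_upwards [Ioo_mem_nhds (neg_lt_zero.2 one_pos) one_pos] with t ht
  have hsum := ((hasSum_geometric_of_abs_lt_one (abs_lt.2 ht)).mul_left 2).sub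
    (hasSum_ite_eq (0 : ℕ) (1 : ℝ))
  have ht1 : 1 - t ≠ 0 := by linarith [ht.2]
  rw [show (1 + t) / (1 - t) = 2 * (1 - t)⁻¹ - 1 by field_simp; ring]
  refine hsum.congr_fun fun n => ?_
  rcases eq_or_ne n 0 with rfl | hn
  · norm_num [cayleySeries]
  · simp [cayleySeries, hn]

theorem one_le_coeff_cayleySeries (n : ℕ) : 1 ≤ cayleySeries.coeff n := by
  rw [cayleySeries, PowerSeries.coeff_mk]; split_ifs <;> norm_num

theorem coeff_cayleySeries_pow_nonneg (k n : ℕ) : 0 ≤ (cayleySeries ^ k).coeff n :=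
  coeff_pow_nonneg (fun n => zero_le_one.trans (one_le_coeff_cayleySeries n)) k n

theorem coeff_zero_cayleySeries_pow (k : ℕ) : (cayleySeries ^ k).coeff 0 = 1 := by
  rw [PowerSeries.coeff_zero_eq_constantCoeff, map_pow]
  simp [cayleySeries, ← PowerSeries.coeff_zero_eq_constantCoeff_apply]

theorem coeff_le_coeff_cayleySeries_pow_mul {P : ℝ⟦X⟧} (hP : ∀ n, 0 ≤ P.coeff n) (k n : ℕ) :
    P.coeff n ≤ (cayleySeries ^ k * P).coeff n :=
  coeff_le_coeff_mul (coeff_cayleySeries_pow_nonneg k) (coeff_zero_cayleySeries_pow k).ge hP n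

theorem coeff_cayleySeries_pow_le_coeff_pow_add (k l n : ℕ) :
    (cayleySeries ^ k).coeff n ≤ (cayleySeries ^ (k + l)).coeff n := by
  rw [add_comm, pow_add]
  exact coeff_le_coeff_cayleySeries_pow_mul (coeff_cayleySeries_pow_nonneg k) l n

theorem coeff_cayleySeries_pow_le (k n : ℕ) : (cayleySeries ^ k).coeff n ≤ (k * 2) ^ n := by
  refine (le_abs_self _).trans (abs_coeff_pow_le_pow (fun n => ?_) k n)
  rw [abs_of_nonneg (zero_le_one.trans (one_le_coeff_cayleySeries n)), cayleySeries,
    PowerSeries.coeff_mk]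
  split_ifs with h
  · exact one_le_pow₀ one_le_two
  · exact le_self_pow₀ one_le_two h

theorem two_mul_X_mul_derivative_cayleySeries :
    2 * PowerSeries.X * PowerSeries.derivative ℝ cayleySeries = cayleySeries ^ 2 - 1 := by
  have hE := cayleySeries_mul_one_sub_X
  have hdE := congrArg (PowerSeries.derivative ℝ) hE
  simp only [Derivation.leibniz, map_sub, map_add, Derivation.map_one_eq_zero,
    PowerSeries.derivative_X, smul_eq_mul] at hdE
  linear_combination (-(PowerSeries.X * PowerSeries.derivative ℝ cayleySeries) -
    (cayleySeries + 1)) * hE + PowerSeries.X * (cayleySeries + 1) * hdE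

theorem two_mul_natCast_mul_coeff_cayleySeries_pow_le (k n : ℕ) :
    2 * n * (cayleySeries ^ k).coeff n ≤ k * (cayleySeries ^ (k + 1)).coeff n := by
  rcases k with _ | k
  · rcases eq_or_ne n 0 with rfl | hn <;> simp [PowerSeries.coeff_one, *]
  have hODE : 2 * (PowerSeries.X * PowerSeries.derivative ℝ (cayleySeries ^ (k + 1))) =
      ((k + 1 : ℕ) : ℝ⟦X⟧) * (cayleySeries ^ (k + 2) - cayleySeries ^ k) := by
    rw [PowerSeries.derivative_pow, Nat.add_sub_cancel]
    linear_combination ((k + 1 : ℕ) : ℝ⟦X⟧) * cayleySeries ^ k *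
      two_mul_X_mul_derivative_cayleySeries
  have hcoeff (P : ℝ⟦X⟧) :
      (PowerSeries.X * PowerSeries.derivative ℝ P).coeff n = n * P.coeff n := by
    rcases n with _ | n
    · simp
    · rw [PowerSeries.coeff_succ_X_mul, PowerSeries.coeff_derivative, mul_comm, Nat.cast_succ]
  have h := congrArg (PowerSeries.coeff n) hODE
  rw [← map_ofNat PowerSeries.C, ← map_natCast PowerSeries.C, PowerSeries.coeff_C_mul,
    PowerSeries.coeff_C_mul, hcoeff, map_sub] at h
  have hlow : 0 ≤ ((k + 1 : ℕ) : ℝ) * (cayleySeries ^ k).coeff n :=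
    mul_nonneg (Nat.cast_nonneg _) (coeff_cayleySeries_pow_nonneg k n)
  linarith

theorem eventually_mul_coeff_cayleySeries_pow_lt (c : ℝ) (k : ℕ) :
    ∀ᶠ n in atTop, c * (cayleySeries ^ k).coeff n < (cayleySeries ^ (k + 1)).coeff n := by
  filter_upwards [eventually_ge_atTop ⌈c * (k + 1)⌉₊] with n hn
  have hpos : 0 < (cayleySeries ^ (k + 1)).coeff n := by
    rw [pow_succ]
    exact zero_lt_one.trans_le <| (one_le_coeff_cayleySeries n).trans <|
      coeff_le_coeff_cayleySeries_pow_mul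
        (fun n => zero_le_one.trans (one_le_coeff_cayleySeries n)) k n
  have hcn : c * (k + 1) * (cayleySeries ^ k).coeff n ≤ n * (cayleySeries ^ k).coeff n :=
    mul_le_mul_of_nonneg_right (Nat.ceil_le.1 hn) (coeff_cayleySeries_pow_nonneg k n)
  nlinarith [two_mul_natCast_mul_coeff_cayleySeries_pow_le k n]

end CayleySeries

section SechSeries

/-- The power series of `cosh √x`. -/
noncomputable def coshSqrtSeries : ℝ⟦X⟧ := PowerSeries.mk fun k => 1 / ((2 * k)! : ℝ)

/-- The power series of `1 / cosh √x`, the symbol of Boole's summation formula. -/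
noncomputable def sechSqrtSeries : ℝ⟦X⟧ := coshSqrtSeries⁻¹

theorem constantCoeff_coshSqrtSeries : coshSqrtSeries.constantCoeff = 1 := by
  simp [coshSqrtSeries, ← PowerSeries.coeff_zero_eq_constantCoeff_apply]

theorem coshSqrtSeries_mul_sechSqrtSeries : coshSqrtSeries * sechSqrtSeries = 1 :=
  PowerSeries.mul_inv_cancel _ (by rw [constantCoeff_coshSqrtSeries]; exact one_ne_zero)

theorem coeff_zero_sechSqrtSeries : sechSqrtSeries.coeff 0 = 1 := by
  rw [PowerSeries.coeff_zero_eq_constantCoeff_apply, sechSqrtSeries,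
    PowerSeries.constantCoeff_inv, constantCoeff_coshSqrtSeries, inv_one]

theorem coeff_succ_sechSqrtSeries (k : ℕ) :
    sechSqrtSeries.coeff (k + 1) = -(sechSqrtSeries.coeff k / 2) -
      ∑ j ∈ Finset.range k, sechSqrtSeries.coeff (k - (j + 1)) / ((2 * (j + 2))! : ℝ) := by
  have h := congrArg (PowerSeries.coeff (k + 1)) coshSqrtSeries_mul_sechSqrtSeries
  rw [PowerSeries.coeff_mul, Finset.Nat.sum_antidiagonal_eq_sum_range_succ_mk,
    Finset.sum_range_succ', Finset.sum_range_succ'] at h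
  have hlin : ∑ j ∈ Finset.range k, sechSqrtSeries.coeff (k - (j + 1)) / ((2 * (j + 2))! : ℝ) +
      sechSqrtSeries.coeff k / 2 + sechSqrtSeries.coeff (k + 1) = 0 := by
    simpa [coshSqrtSeries, PowerSeries.coeff_one, div_eq_inv_mul, add_assoc] using h
  linarith

theorem cosh_two_le_four : Real.cosh 2 ≤ 4 := by
  have hneg : Real.exp (-2) ≤ 1 / 2 := by
    rw [Real.exp_neg, one_div]
    exact inv_anti₀ two_pos (by linarith [Real.add_one_le_exp 2])
  have hpos : Real.exp 2 ≤ 7.4 := by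
    rw [show (2 : ℝ) = 1 + 1 by norm_num, Real.exp_add]
    nlinarith [Real.exp_one_lt_d9, Real.exp_pos 1]
  rw [Real.cosh_eq]
  linarith

theorem sum_four_pow_div_factorial_le_one (k : ℕ) :
    ∑ j ∈ Finset.range k, (4 : ℝ) ^ (j + 2) / ((2 * (j + 2))! : ℝ) ≤ 1 := by
  have hle := sum_le_hasSum (Finset.range (k + 2)) (fun n _ => by positivity) (Real.hasSum_cosh 2)
  have hlow : ∑ j ∈ Finset.range (k + 2), (2 : ℝ) ^ (2 * j) / ((2 * j)! : ℝ) =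
      ∑ j ∈ Finset.range k, (4 : ℝ) ^ (j + 2) / ((2 * (j + 2))! : ℝ) + 2 + 1 := by
    rw [Finset.sum_range_succ', Finset.sum_range_succ']
    norm_num [pow_mul]
  linarith [cosh_two_le_four]

/-- The recurrence gives `v (k + 1) ≥ 2 * v k - v k` for `v i = (-4) ^ i * sechSqrtSeries.coeff i`,
as long as `v k` dominates all earlier `v i`. -/
theorem abs_neg_four_pow_mul_coeff_sechSqrtSeries_le {i k : ℕ} (hik : i ≤ k) :
    |(-4) ^ i * sechSqrtSeries.coeff i| ≤ (-4) ^ k * sechSqrtSeries.coeff k := by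
  induction k generalizing i with
  | zero => simp [Nat.le_zero.1 hik, coeff_zero_sechSqrtSeries]
  | succ k ih =>
    set v : ℕ → ℝ := fun i => (-4) ^ i * sechSqrtSeries.coeff i with hv
    have hvk : 0 ≤ v k := (abs_nonneg _).trans (ih le_rfl)
    have hrec : v (k + 1) = 2 * v k -
        ∑ j ∈ Finset.range k, (-4) ^ (j + 2) / ((2 * (j + 2))! : ℝ) * v (k - (j + 1)) := by
      simp only [hv, coeff_succ_sechSqrtSeries, mul_sub, Finset.mul_sum]
      congr 1
      · ring
      · refine Finset.sum_congr rfl fun j hj => ?_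
        have hexp : k + 1 = j + 2 + (k - (j + 1)) := by have := Finset.mem_range.1 hj; omega
        rw [hexp, pow_add]
        ring
    have htail : ∑ j ∈ Finset.range k, (-4) ^ (j + 2) / ((2 * (j + 2))! : ℝ) * v (k - (j + 1)) ≤
        v k := by
      calc _ ≤ ∑ j ∈ Finset.range k, 4 ^ (j + 2) / ((2 * (j + 2))! : ℝ) * v k := by
            refine Finset.sum_le_sum fun j _ => (le_abs_self _).trans ?_
            rw [abs_mul, abs_div, abs_pow, abs_neg, Nat.abs_cast, Nat.abs_ofNat]
            gcongr
            exact ih (by omega)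
        _ ≤ 1 * v k := by
            rw [← Finset.sum_mul]
            gcongr
            exact sum_four_pow_div_factorial_le_one k
        _ = v k := one_mul _
    have hmono : v k ≤ v (k + 1) := by linarith
    rcases hik.eq_or_lt with rfl | hlt
    · exact (abs_of_nonneg (hvk.trans hmono)).le
    · exact (ih (Nat.lt_succ_iff.1 hlt)).trans hmono

theorem one_fourth_pow_le_neg_one_pow_mul_coeff_sechSqrtSeries (k : ℕ) :
    (1 / 4 : ℝ) ^ k ≤ (-1) ^ k * sechSqrtSeries.coeff k := by
  have h := abs_neg_four_pow_mul_coeff_sechSqrtSeries_le k.zero_le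
  rw [pow_zero, one_mul, coeff_zero_sechSqrtSeries, abs_one, neg_pow, mul_right_comm] at h
  rw [one_div, inv_pow, inv_le_iff_one_le_mul₀ (by positivity)]
  exact h

end SechSeries

section Boole

theorem exists_taylor_remainder_eq {f : ℝ → ℝ} {N : ℕ} (hf : ContDiff ℝ N f) (y s : ℝ) :
    ∃ ξ, |ξ - y| ≤ |s| ∧
      f (y + s) - ∑ j ∈ Finset.range N, s ^ j / (j ! : ℝ) * iteratedDeriv j f y =
        iteratedDeriv N f ξ * s ^ N / (N ! : ℝ) := by
  rcases N with _ | n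
  · exact ⟨y + s, by simp⟩
  rcases eq_or_ne s 0 with rfl | hs
  · exact ⟨y, by simp, by simp [Finset.sum_range_succ']⟩
  have hy : y ≠ y + s := by simpa using hs
  obtain ⟨ξ, hξ, h⟩ := taylor_mean_remainder_lagrange_iteratedDeriv hy
    (by exact_mod_cast hf.contDiffOn)
  refine ⟨ξ, ?_, ?_⟩
  · simpa using Set.abs_sub_left_of_mem_uIcc (Set.uIoo_subset_uIcc_self hξ)
  · rw [taylor_within_apply, add_sub_cancel_left] at h
    rw [← h]
    congr 1
    refine Finset.sum_congr rfl fun j hj => ?_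
    have hj' : ((j : ℕ∞) : WithTop ℕ∞) ≤ (n + 1 : ℕ) := by
      exact_mod_cast (Finset.mem_range.1 hj).le
    rw [iteratedDerivWithin_eq_iteratedDeriv (uniqueDiffOn_uIcc hy)
      ((hf.of_le hj').contDiffAt) Set.left_mem_uIcc, smul_eq_mul, div_eq_inv_mul]

theorem one_div_one_add_sq_le_three_mul {y ξ : ℝ} (h : |ξ - y| ≤ 1) :
    1 / (1 + ξ ^ 2) ≤ 3 * (1 / (1 + y ^ 2)) := by
  rw [mul_one_div, div_le_div_iff₀ (by positivity) (by positivity)]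
  have hsq : (ξ - y) ^ 2 ≤ 1 := (sq_le_one_iff_abs_le_one _).2 h
  nlinarith [sq_nonneg (2 * ξ - y), sq_nonneg ξ]

theorem schwartz_isBigO_one_div_one_add_sq (f : 𝓢(ℝ, ℝ)) :
    f =O[⊤] fun y : ℝ => 1 / (1 + y ^ 2) := by
  obtain ⟨C₀, -, h0⟩ := f.decay 0 0
  obtain ⟨C₂, -, h2⟩ := f.decay 2 0
  refine IsBigO.of_bound (C₀ + C₂) (Eventually.of_forall fun y => ?_)
  have h0y := h0 y
  have h2y := h2 y
  simp only [norm_iteratedFDeriv_zero, pow_zero, one_mul, Real.norm_eq_abs, sq_abs] at h0y h2y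
  rw [Real.norm_eq_abs, Real.norm_of_nonneg (by positivity), mul_one_div,
    le_div_iff₀ (by positivity)]
  linarith

/-- The operator `δ² D²` on Schwartz functions; the average of the translations by `±δ` is
`cosh √` of it. -/
noncomputable def scaledSecondDeriv (δ : ℝ) : Module.End ℝ 𝓢(ℝ, ℝ) :=
  δ ^ 2 • (SchwartzMap.derivCLM ℝ ℝ).toLinearMap ^ 2

theorem scaledSecondDeriv_pow (δ : ℝ) (k : ℕ) :
    scaledSecondDeriv δ ^ k = δ ^ (2 * k) • scaledSecondDeriv 1 ^ k := by
  simp [scaledSecondDeriv, smul_pow, pow_mul]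

theorem derivCLM_pow_apply (k : ℕ) (f : 𝓢(ℝ, ℝ)) (y : ℝ) :
    ((SchwartzMap.derivCLM ℝ ℝ).toLinearMap ^ k : Module.End ℝ 𝓢(ℝ, ℝ)) f y =
      iteratedDeriv k f y := by
  induction k generalizing f with
  | zero => simp
  | succ k ih =>
    rw [pow_succ, Module.End.mul_apply, ih, iteratedDeriv_succ']
    rfl

theorem scaledSecondDeriv_pow_apply (δ : ℝ) (k : ℕ) (f : 𝓢(ℝ, ℝ)) (y : ℝ) :
    (scaledSecondDeriv δ ^ k) f y = δ ^ (2 * k) * iteratedDeriv (2 * k) f y := by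
  rw [scaledSecondDeriv, smul_pow, ← pow_mul, ← pow_mul, LinearMap.smul_apply,
    smul_apply, derivCLM_pow_apply, smul_eq_mul]

theorem aeval_trunc_scaledSecondDeriv_apply (P : ℝ⟦X⟧) (N : ℕ) (δ : ℝ) (f : 𝓢(ℝ, ℝ)) (y : ℝ) :
    Polynomial.aeval (scaledSecondDeriv δ) (P.trunc N) f y =
      ∑ k ∈ Finset.range N, P.coeff k * (δ ^ (2 * k) * iteratedDeriv (2 * k) f y) := by
  induction N with
  | zero => simp [PowerSeries.trunc_zero']
  | succ N ih =>
    rw [PowerSeries.trunc_succ, map_add, LinearMap.add_apply, add_apply, ih, Finset.sum_range_succ,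
      Polynomial.aeval_monomial, Module.End.mul_apply, Module.algebraMap_end_apply, smul_apply,
      scaledSecondDeriv_pow_apply, smul_eq_mul]

theorem isBigO_mul_fst_pow_one (c : ℝ) (k : ℕ) :
    (fun x : ℝ × ℝ => c * x.1 ^ k) =O[𝓝 0 ×ˢ ⊤] fun _ => (1 : ℝ) := by
  have hcont : Continuous fun δ : ℝ => c * δ ^ k := by fun_prop
  exact (hcont.continuousAt.isBigO_one ℝ).comp_tendsto tendsto_fst

theorem isBigO_aeval_scaledSecondDeriv (p : ℝ[X]) (f : 𝓢(ℝ, ℝ)) :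
    (fun x : ℝ × ℝ => Polynomial.aeval (scaledSecondDeriv x.1) p f x.2)
      =O[𝓝 0 ×ˢ ⊤] fun x => 1 / (1 + x.2 ^ 2) := by
  induction p using Polynomial.induction_on' with
  | add p q hp hq => simpa using hp.add hq
  | monomial k c =>
    have hf := (schwartz_isBigO_one_div_one_add_sq ((scaledSecondDeriv 1 ^ k) f)).comp_tendsto
      (tendsto_snd (f := 𝓝 (0 : ℝ)))
    refine ((isBigO_mul_fst_pow_one c (2 * k)).mul hf).congr (fun x => ?_) fun x => one_mul _
    rw [Polynomial.aeval_monomial, scaledSecondDeriv_pow x.1]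
    simp [mul_assoc, mul_left_comm]

theorem isBigO_sub_taylor (f : 𝓢(ℝ, ℝ)) (N : ℕ) :
    (fun x : ℝ × ℝ => f (x.2 + x.1) -
        ∑ j ∈ Finset.range N, x.1 ^ j / (j ! : ℝ) * iteratedDeriv j f x.2)
      =O[𝓝 0 ×ˢ ⊤] fun x => x.1 ^ N * (1 / (1 + x.2 ^ 2)) := by
  obtain ⟨C, hC⟩ := (schwartz_isBigO_one_div_one_add_sq
    (((SchwartzMap.derivCLM ℝ ℝ).toLinearMap ^ N : Module.End ℝ 𝓢(ℝ, ℝ)) f)).bound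
  simp only [eventually_top, derivCLM_pow_apply] at hC
  refine IsBigO.of_bound (3 * C) ?_
  have hsmall : ∀ᶠ s : ℝ in 𝓝 0, |s| ≤ 1 := by
    filter_upwards [Icc_mem_nhds (neg_lt_zero.2 one_pos) one_pos] with s hs using abs_le.2 hs
  filter_upwards [tendsto_fst.eventually hsmall] with x hx
  obtain ⟨ξ, hξ, h⟩ := exists_taylor_remainder_eq (f.smooth N) x.2 x.1
  have hC0 : 0 ≤ C := by simpa using (norm_nonneg _).trans (hC 0)
  have hfactorial : (1 : ℝ) ≤ (N ! : ℝ) := by exact_mod_cast N.factorial_pos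
  have hderiv : |iteratedDeriv N f ξ| ≤ 3 * C * (1 / (1 + x.2 ^ 2)) := by
    calc |iteratedDeriv N f ξ| ≤ C * (1 / (1 + ξ ^ 2)) := by
          simpa [abs_of_pos (by positivity : 0 < 1 + ξ ^ 2)] using hC ξ
      _ ≤ C * (3 * (1 / (1 + x.2 ^ 2))) := by
          gcongr
          exact one_div_one_add_sq_le_three_mul (hξ.trans hx)
      _ = 3 * C * (1 / (1 + x.2 ^ 2)) := by ring
  rw [h, Real.norm_eq_abs, abs_div, abs_mul, Nat.abs_cast, norm_mul, Real.norm_eq_abs,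
    Real.norm_of_nonneg (by positivity : 0 ≤ 1 / (1 + x.2 ^ 2))]
  calc |iteratedDeriv N f ξ| * |x.1 ^ N| / (N ! : ℝ)
      ≤ |iteratedDeriv N f ξ| * |x.1 ^ N| := div_le_self (by positivity) hfactorial
    _ ≤ 3 * C * (1 / (1 + x.2 ^ 2)) * |x.1 ^ N| := by gcongr
    _ = 3 * C * (|x.1 ^ N| * (1 / (1 + x.2 ^ 2))) := by ring

theorem sum_range_two_mul_add_neg (s : ℝ) (d : ℕ → ℝ) (N : ℕ) :
    ∑ j ∈ Finset.range (2 * N), s ^ j / (j ! : ℝ) * d j +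
      ∑ j ∈ Finset.range (2 * N), (-s) ^ j / (j ! : ℝ) * d j =
    2 * ∑ k ∈ Finset.range N, s ^ (2 * k) / ((2 * k)! : ℝ) * d (2 * k) := by
  induction N with
  | zero => simp
  | succ N ih =>
    simp only [Nat.mul_succ, Finset.sum_range_succ]
    rw [(even_two_mul N).neg_pow, (odd_two_mul_add_one N).neg_pow]
    linear_combination ih

theorem isBigO_average_sub_aeval_coshSqrtSeries (f : 𝓢(ℝ, ℝ)) (N : ℕ) :
    (fun x : ℝ × ℝ => (f (x.2 + x.1) + f (x.2 - x.1)) / 2 -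
        Polynomial.aeval (scaledSecondDeriv x.1) (coshSqrtSeries.trunc N) f x.2)
      =O[𝓝 0 ×ˢ ⊤] fun x => x.1 ^ (2 * N) * (1 / (1 + x.2 ^ 2)) := by
  have hpos := isBigO_sub_taylor f (2 * N)
  have hreflect : Tendsto (fun x : ℝ × ℝ => (-x.1, x.2)) (𝓝 0 ×ˢ ⊤) (𝓝 0 ×ˢ ⊤) := by
    refine Tendsto.prodMk ?_ tendsto_snd
    simpa using (tendsto_fst (f := 𝓝 (0 : ℝ)) (g := (⊤ : Filter ℝ))).neg
  have hneg := (hpos.comp_tendsto hreflect).congr_right (g₂ := fun x : ℝ × ℝ =>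
    x.1 ^ (2 * N) * (1 / (1 + x.2 ^ 2))) fun x => by simp [(even_two_mul N).neg_pow]
  refine ((hpos.add hneg).const_mul_left (1 / 2)).congr_left fun x => ?_
  have heven := sum_range_two_mul_add_neg x.1 (fun j => iteratedDeriv j f x.2) N
  rw [aeval_trunc_scaledSecondDeriv_apply]
  simp only [coshSqrtSeries, PowerSeries.coeff_mk, Function.comp_apply, one_div_mul_eq_div,
    mul_div_right_comm, sub_eq_add_neg] at heven ⊢
  linarith

/-- Truncation of Boole's operator `1 / cosh (δ D)`, which inverts the average of the translations
by `±δ` up to `O(δ ^ (2 * N))`. -/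
noncomputable def booleOperator (N : ℕ) (δ : ℝ) : Module.End ℝ 𝓢(ℝ, ℝ) :=
  Polynomial.aeval (scaledSecondDeriv δ) (sechSqrtSeries.trunc N)

theorem isBigO_average_aeval_sub (p : ℝ[X]) (f : 𝓢(ℝ, ℝ)) (N : ℕ) :
    (fun x : ℝ × ℝ => (Polynomial.aeval (scaledSecondDeriv x.1) p f (x.2 + x.1) +
          Polynomial.aeval (scaledSecondDeriv x.1) p f (x.2 - x.1)) / 2 -
        Polynomial.aeval (scaledSecondDeriv x.1) (coshSqrtSeries.trunc N * p) f x.2)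
      =O[𝓝 0 ×ˢ ⊤] fun x => x.1 ^ (2 * N) * (1 / (1 + x.2 ^ 2)) := by
  induction p using Polynomial.induction_on' with
  | add p q hp hq =>
    refine (hp.add hq).congr_left fun x => ?_
    simp only [mul_add, map_add, LinearMap.add_apply, add_apply]
    ring
  | monomial k c =>
    have hf := isBigO_average_sub_aeval_coshSqrtSeries ((scaledSecondDeriv 1 ^ k) f) N
    refine ((isBigO_mul_fst_pow_one c (2 * k)).mul hf).congr (fun x => ?_) fun x => one_mul _
    rw [map_mul, Polynomial.aeval_monomial, scaledSecondDeriv_pow x.1 k]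
    simp only [Module.End.mul_apply, Module.algebraMap_end_apply, LinearMap.smul_apply, map_smul,
      smul_apply, smul_eq_mul]
    ring

theorem exists_coshSqrt_trunc_mul_sechSqrt_trunc (N : ℕ) :
    ∃ q : ℝ[X], coshSqrtSeries.trunc N * sechSqrtSeries.trunc N = 1 + q * Polynomial.X ^ N := by
  have hdvd : Polynomial.X ^ N ∣ coshSqrtSeries.trunc N * sechSqrtSeries.trunc N - 1 := by
    rw [Polynomial.X_pow_dvd_iff]
    intro n hn
    have h := congrArg (Polynomial.coeff · n)
      (PowerSeries.trunc_trunc_mul_trunc (n := N) coshSqrtSeries sechSqrtSeries)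
    simp only [coshSqrtSeries_mul_sechSqrtSeries, PowerSeries.coeff_trunc, if_pos hn,
      ← Polynomial.coe_mul, Polynomial.coeff_coe, PowerSeries.coeff_one] at h
    rw [Polynomial.coeff_sub, Polynomial.coeff_one, h, sub_self]
  obtain ⟨q, hq⟩ := hdvd
  exact ⟨q, by rw [← sub_eq_iff_eq_add', hq, mul_comm]⟩

theorem isBigO_average_booleOperator_sub (f : 𝓢(ℝ, ℝ)) (N : ℕ) :
    (fun x : ℝ × ℝ => (booleOperator N x.1 f (x.2 + x.1) +
        booleOperator N x.1 f (x.2 - x.1)) / 2 - f x.2)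
      =O[𝓝 0 ×ˢ ⊤] fun x => x.1 ^ (2 * N) * (1 / (1 + x.2 ^ 2)) := by
  obtain ⟨q, hq⟩ := exists_coshSqrt_trunc_mul_sechSqrt_trunc N
  have haverage := isBigO_average_aeval_sub (sechSqrtSeries.trunc N) f N
  have hrest : (fun x : ℝ × ℝ => x.1 ^ (2 * N) *
      Polynomial.aeval (scaledSecondDeriv x.1) q ((scaledSecondDeriv 1 ^ N) f) x.2)
      =O[𝓝 0 ×ˢ ⊤] fun x => x.1 ^ (2 * N) * (1 / (1 + x.2 ^ 2)) :=
    (isBigO_refl _ _).mul (isBigO_aeval_scaledSecondDeriv q _)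
  refine (haverage.add hrest).congr_left fun x => ?_
  rw [hq]
  simp only [booleOperator, map_add, map_mul, map_pow, map_one, Polynomial.aeval_X,
    scaledSecondDeriv_pow x.1 N, LinearMap.add_apply, Module.End.mul_apply, Module.End.one_apply,
    LinearMap.smul_apply, map_smul, add_apply, smul_apply, smul_eq_mul]
  ring

theorem summable_one_div_one_add_sq {a : ℝ} (ha : a ≠ 0) (x : ℝ) :
    Summable fun n : ℕ => 1 / (1 + (a * (n + x)) ^ 2) := by
  have hsq : Summable fun n : ℕ => 1 / ((n : ℝ) + 1) ^ 2 := by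
    exact_mod_cast (summable_nat_add_iff 1).2 (Real.summable_one_div_nat_pow.2 one_lt_two)
  refine Summable.of_nonneg_of_le (fun n => by positivity) (fun n => ?_)
    (hsq.mul_left ((2 + 2 * (a * (1 - x)) ^ 2) / a ^ 2))
  rw [div_mul_div_comm, mul_one, div_le_div_iff₀ (by positivity) (by positivity), one_mul]
  have hsplit : (a * (n + 1)) ^ 2 ≤ 2 * (a * (n + x)) ^ 2 + 2 * (a * (1 - x)) ^ 2 := by
    nlinarith [sq_nonneg (a * (n + x) - a * (1 - x))]
  nlinarith [mul_nonneg (sq_nonneg (a * (1 - x))) (sq_nonneg (a * (n + x)))]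

theorem summable_schwartz_arithmetic (f : 𝓢(ℝ, ℝ)) {a : ℝ} (ha : a ≠ 0) (x : ℝ) :
    Summable fun n : ℕ => f (a * (n + x)) := by
  obtain ⟨C, hC⟩ := (schwartz_isBigO_one_div_one_add_sq f).bound
  rw [eventually_top] at hC
  refine Summable.of_norm_bounded ((summable_one_div_one_add_sq ha x).mul_left C) fun n => ?_
  have hpos : 0 ≤ 1 / (1 + (a * (n + x)) ^ 2) := by positivity
  simpa only [Real.norm_of_nonneg hpos] using hC (a * (n + x))

theorem pow_mul_one_div_one_add_sq_le {δ : ℝ} (hδ0 : 0 ≤ δ) (hδ1 : δ ≤ 1) (N : ℕ) (z : ℝ) :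
    δ ^ (2 * (N + 1)) * (1 / (1 + (2 * δ * z) ^ 2)) ≤ δ ^ (2 * N) * (1 / (1 + z ^ 2)) := by
  rw [Nat.mul_succ, pow_add, mul_assoc]
  gcongr
  rw [mul_one_div, div_le_div_iff₀ (by positivity) (by positivity)]
  nlinarith [pow_le_one₀ hδ0 hδ1 (n := 2), mul_nonneg (sq_nonneg δ) (sq_nonneg z)]

theorem hasSum_neg_one_pow_mul_add_succ {v : ℕ → ℝ} (hv : Summable v) :
    HasSum (fun n => (-1) ^ n * (v n + v (n + 1))) (v 0) := by
  have halt := hv.alternating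
  have hsucc := halt.hasSum.sub ((hasSum_nat_add_iff' 1).2 halt.hasSum)
  simp only [Finset.sum_range_one, pow_zero, one_mul, sub_sub_cancel] at hsucc
  refine hsucc.congr_fun fun n => ?_
  ring

theorem hasSum_neg_one_pow_mul_average (g : 𝓢(ℝ, ℝ)) {δ : ℝ} (hδ : δ ≠ 0) (x : ℝ) :
    HasSum (fun n : ℕ => (-1) ^ n * ((g (2 * δ * (n + x) + δ) + g (2 * δ * (n + x) - δ)) / 2))
      (g (2 * δ * x - δ) / 2) := by
  have hright (n : ℕ) : 2 * δ * (n + x) + δ = 2 * δ * ((n + 1 : ℕ) + (x - 1 / 2)) := by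
    push_cast
    ring
  have hleft (n : ℕ) : 2 * δ * (n + x) - δ = 2 * δ * (n + (x - 1 / 2)) := by ring
  have hzero : 2 * δ * x - δ = 2 * δ * ((0 : ℕ) + (x - 1 / 2)) := by
    push_cast
    ring
  simp only [hright, hleft, hzero]
  refine ((hasSum_neg_one_pow_mul_add_succ (summable_schwartz_arithmetic g
    (mul_ne_zero two_ne_zero hδ) (x - 1 / 2))).div_const 2).congr_fun fun n => ?_
  ring

/-- Boole's summation formula: the average of `booleOperator N δ f` over the two neighbouring points
is almost `f`, and alternating sums of such averages telescope. -/
theorem isBigO_tsum_neg_one_pow_sub_booleOperator (f : 𝓢(ℝ, ℝ)) (x : ℝ) (N : ℕ) :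
    (fun δ => ∑' n : ℕ, (-1) ^ n * f (2 * δ * (n + x)) -
        booleOperator (N + 1) δ f (2 * δ * x - δ) / 2)
      =O[𝓝[>] 0] fun δ => δ ^ (2 * N) := by
  obtain ⟨C, hC0, hC⟩ := (isBigO_average_booleOperator_sub f (N + 1)).exists_nonneg
  obtain ⟨s, hs, t, ht, hst⟩ := mem_prod_iff.1 hC.bound
  rw [mem_top] at ht
  have hsum : Summable fun n : ℕ => 1 / (1 + (n + x) ^ 2) := by
    simpa only [one_mul] using summable_one_div_one_add_sq one_ne_zero x
  refine IsBigO.of_bound (C * ∑' n : ℕ, 1 / (1 + (n + x) ^ 2)) ?_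
  filter_upwards [mem_nhdsWithin_of_mem_nhds hs, Ioc_mem_nhdsGT one_pos] with δ hδs hδ
  set g := booleOperator (N + 1) δ f
  have hf := summable_schwartz_arithmetic f (mul_ne_zero two_ne_zero hδ.1.ne') x
  have hdiff := hf.alternating.hasSum.sub (hasSum_neg_one_pow_mul_average g hδ.1.ne' x)
  have hbound (n : ℕ) : ‖(-1) ^ n * f (2 * δ * (n + x)) - (-1) ^ n *
      ((g (2 * δ * (n + x) + δ) + g (2 * δ * (n + x) - δ)) / 2)‖ ≤
      C * δ ^ (2 * N) * (1 / (1 + (n + x) ^ 2)) := by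
    have hpoint := hst (Set.mk_mem_prod hδs (ht ▸ Set.mem_univ (2 * δ * (n + x))))
    have hpos : 0 ≤ δ ^ (2 * (N + 1)) * (1 / (1 + (2 * δ * (n + x)) ^ 2)) := by
      have := hδ.1.le
      positivity
    simp only [Set.mem_ofPred_eq, Real.norm_of_nonneg hpos] at hpoint
    rw [← mul_sub, norm_mul, norm_pow, norm_neg, norm_one, one_pow, one_mul, norm_sub_rev,
      mul_assoc C]
    exact hpoint.trans
      (mul_le_mul_of_nonneg_left (pow_mul_one_div_one_add_sq_le hδ.1.le hδ.2 N _) hC0)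
  rw [← hdiff.tsum_eq, Real.norm_of_nonneg (pow_nonneg hδ.1.le _), mul_right_comm]
  exact tsum_of_norm_bounded (hsum.hasSum.mul_left _) hbound

theorem booleOperator_apply_neg {f : 𝓢(ℝ, ℝ)} (hf : ∀ y, f (-y) = f y) (N : ℕ) (δ y : ℝ) :
    booleOperator N δ f (-y) = booleOperator N δ f y := by
  simp only [booleOperator, aeval_trunc_scaledSecondDeriv_apply]
  refine Finset.sum_congr rfl fun k _ => ?_
  have h := iteratedDeriv_comp_neg (2 * k) f y
  simp only [hf, (even_two_mul k).neg_one_pow, one_smul] at h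
  rw [h]

theorem isBigO_booleOperator_self_sub {f : 𝓢(ℝ, ℝ)} (hf : ∀ y, f (-y) = f y) (N : ℕ) :
    (fun δ => booleOperator N δ f δ - f 0) =O[𝓝 0] fun δ => δ ^ (2 * N) := by
  have hzero : Tendsto (fun δ : ℝ => (δ, (0 : ℝ))) (𝓝 0) (𝓝 0 ×ˢ ⊤) :=
    tendsto_id.prodMk tendsto_top
  have haverage := (isBigO_average_booleOperator_sub f N).comp_tendsto hzero
  refine haverage.congr (fun δ => ?_) fun δ => ?_
  · rw [Function.comp_apply, zero_add, zero_sub, booleOperator_apply_neg hf, add_self_div_two]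
  · simp

end Boole

section Gaussian

theorem exists_abs_eval_mul_exp_le (p : ℝ[X]) :
    ∃ C, ∀ y : ℝ, |p.eval y * Real.exp (-(y ^ 2 / 2))| ≤ C := by
  induction p using Polynomial.induction_on' with
  | add p q hp hq =>
    obtain ⟨C, hC⟩ := hp
    obtain ⟨D, hD⟩ := hq
    refine ⟨C + D, fun y => ?_⟩
    rw [Polynomial.eval_add, add_mul]
    exact (abs_add_le _ _).trans (add_le_add (hC y) (hD y))
  | monomial n a =>
    refine ⟨|a| * (1 + 2 ^ n * n !), fun y => ?_⟩
    have hone : 1 ≤ Real.exp (y ^ 2 / 2) := Real.one_le_exp (by positivity)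
    have hpow : (y ^ n) ^ 2 ≤ 2 ^ n * n ! * Real.exp (y ^ 2 / 2) := by
      have h := Real.pow_div_factorial_le_exp (y ^ 2 / 2) (by positivity) n
      rw [div_pow, div_div, div_le_iff₀ (by positivity)] at h
      rw [← pow_mul, mul_comm n, pow_mul]
      linarith
    rw [Polynomial.eval_monomial, Real.exp_neg, ← div_eq_mul_inv, abs_div, abs_mul, Real.abs_exp,
      div_le_iff₀ (Real.exp_pos _), mul_assoc]
    gcongr
    nlinarith [sq_nonneg (|y ^ n| - 1), sq_abs (y ^ n), abs_nonneg (y ^ n)]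

theorem iteratedDeriv_gaussian (n : ℕ) (y : ℝ) :
    iteratedDeriv n (fun y : ℝ => Real.exp (-(y ^ 2 / 2))) y =
      (-1) ^ n * (Polynomial.aeval y (Polynomial.hermite n) * Real.exp (-(y ^ 2 / 2))) := by
  rw [iteratedDeriv_eq_iterate, Polynomial.deriv_gaussian_eq_hermite_mul_gaussian, mul_assoc]

/-- The Gaussian `exp (-y² / 2)` as a Schwartz function. -/
noncomputable def gaussianSchwartz : 𝓢(ℝ, ℝ) where
  toFun y := Real.exp (-(y ^ 2 / 2))
  smooth' := by fun_prop
  decay' k n := by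
    obtain ⟨C, hC⟩ := exists_abs_eval_mul_exp_le
      (Polynomial.X ^ k * (Polynomial.hermite n).map (algebraMap ℤ ℝ))
    refine ⟨C, fun y => le_of_eq_of_le ?_ (hC y)⟩
    rw [norm_iteratedFDeriv_eq_norm_iteratedDeriv, iteratedDeriv_gaussian, Polynomial.eval_mul,
      Polynomial.eval_map_algebraMap, Polynomial.eval_pow, Polynomial.eval_X, mul_assoc, abs_mul,
      abs_pow, norm_mul, norm_pow, norm_neg, norm_one, one_pow, one_mul, Real.norm_eq_abs,
      Real.norm_eq_abs]

theorem gaussianSchwartz_apply (y : ℝ) : gaussianSchwartz y = Real.exp (-(y ^ 2 / 2)) := rfl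

theorem gaussianSchwartz_neg (y : ℝ) : gaussianSchwartz (-y) = gaussianSchwartz y := by
  rw [gaussianSchwartz_apply, gaussianSchwartz_apply, neg_sq]

theorem iteratedDeriv_two_mul_gaussianSchwartz_zero (k : ℕ) :
    iteratedDeriv (2 * k) gaussianSchwartz 0 = (-1) ^ k * ((2 * k - 1)‼ : ℝ) := by
  have hcoeff := Polynomial.coeff_hermite_explicit k 0
  rw [add_zero, Nat.choose_zero_right, Nat.cast_one, mul_one] at hcoeff
  refine (iteratedDeriv_gaussian (2 * k) 0).trans ?_
  rw [← Polynomial.eval_map_algebraMap, ← Polynomial.coeff_zero_eq_eval_zero,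
    Polynomial.coeff_map, hcoeff]
  simp

/-- The expansion in `w` of `2 ∑ (-1)^n exp (-w (n + 1/2)²)`. -/
noncomputable def alternatingGaussSeries : ℝ⟦X⟧ :=
  PowerSeries.mk fun k => (-1) ^ k * sechSqrtSeries.coeff k * (2 * k - 1)‼ / 2 ^ k

theorem booleOperator_gaussianSchwartz_zero (N : ℕ) (δ : ℝ) :
    booleOperator N δ gaussianSchwartz 0 = (alternatingGaussSeries.trunc N).eval (2 * δ ^ 2) := by
  rw [booleOperator, aeval_trunc_scaledSecondDeriv_apply, eval_trunc_eq_sum]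
  refine Finset.sum_congr rfl fun k _ => ?_
  rw [iteratedDeriv_two_mul_gaussianSchwartz_zero, alternatingGaussSeries, PowerSeries.coeff_mk,
    mul_pow, pow_mul]
  field_simp

theorem tendsto_sqrt_half_nhdsGT_zero :
    Tendsto (fun w : ℝ => √(w / 2)) (𝓝[>] 0) (𝓝[>] 0) := by
  refine tendsto_nhdsWithin_iff.2 ⟨?_, ?_⟩
  · have hcont : Continuous fun w : ℝ => √(w / 2) := by fun_prop
    simpa using hcont.continuousAt.tendsto.mono_left (nhdsWithin_le_nhds (a := (0 : ℝ)))
  · filter_upwards [self_mem_nhdsWithin] with w hw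
    exact Real.sqrt_pos.2 (half_pos hw)

theorem isBigO_sqrt_half_pow_two_mul (N : ℕ) :
    (fun w : ℝ => √(w / 2) ^ (2 * N)) =O[𝓝[>] 0] fun w => w ^ N := by
  refine ((isBigO_refl (fun w : ℝ => w ^ N) _).const_mul_left ((1 / 2) ^ N)).congr' ?_ .rfl
  filter_upwards [self_mem_nhdsWithin] with w hw
  rw [pow_mul, Real.sq_sqrt (half_pos hw).le, ← mul_pow, one_div_mul_eq_div]

/-- At the sampling points `y = 2 δ (n + x)` the Gaussian `exp (-y² / 2)` equals
`exp (-w (n + x)²)` for `w = 2 δ²`, whence the step `δ = √(w / 2)`. -/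
theorem isBigO_tsum_neg_one_pow_mul_exp_sub (x : ℝ) (N : ℕ) :
    (fun w => 2 * ∑' n : ℕ, (-1) ^ n * Real.exp (-w * (n + x) ^ 2) -
        booleOperator (N + 1) √(w / 2) gaussianSchwartz (2 * √(w / 2) * x - √(w / 2)))
      =O[𝓝[>] 0] fun w => w ^ N := by
  have hboole := ((isBigO_tsum_neg_one_pow_sub_booleOperator gaussianSchwartz x N).comp_tendsto
    tendsto_sqrt_half_nhdsGT_zero).trans (isBigO_sqrt_half_pow_two_mul N)
  refine (hboole.const_mul_left 2).congr' ?_ .rfl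
  filter_upwards [self_mem_nhdsWithin] with w hw
  have hsq : √(w / 2) ^ 2 = w / 2 := Real.sq_sqrt (half_pos hw).le
  have hexp (n : ℕ) : gaussianSchwartz (2 * √(w / 2) * (n + x)) = Real.exp (-w * (n + x) ^ 2) := by
    rw [gaussianSchwartz_apply, mul_pow, mul_pow, hsq]
    ring_nf
  simp only [Function.comp_apply, hexp]
  ring

theorem hasSeriesExpansion_alternatingGauss :
    HasSeriesExpansion (fun w => 2 * ∑' n : ℕ, (-1) ^ n * Real.exp (-w * (n + 1 / 2) ^ 2))
      alternatingGaussSeries := by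
  refine HasSeriesExpansion.of_forall_exists fun N => ⟨alternatingGaussSeries.trunc (N + 1),
    (pow_dvd_pow _ N.le_succ).trans (X_pow_dvd_sub_trunc _ _), ?_⟩
  refine (isBigO_tsum_neg_one_pow_mul_exp_sub (1 / 2) N).congr' ?_ .rfl
  filter_upwards [self_mem_nhdsWithin] with w hw
  rw [mul_assoc, mul_one_div, mul_div_cancel₀ _ two_ne_zero, sub_self,
    booleOperator_gaussianSchwartz_zero, Real.sq_sqrt (half_pos hw).le,
    mul_div_cancel₀ _ two_ne_zero]

theorem hasSeriesExpansion_two_mul_tsum_succ :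
    HasSeriesExpansion (fun w => 2 * ∑' n : ℕ, (-1) ^ n * Real.exp (-w * (n + 1) ^ 2)) 1 := by
  refine HasSeriesExpansion.of_forall_exists fun N => ⟨1, by simp, ?_⟩
  have hzero : gaussianSchwartz 0 = 1 := by simp [gaussianSchwartz_apply]
  have hself := (((isBigO_booleOperator_self_sub gaussianSchwartz_neg (N + 1)).mono
    nhdsWithin_le_nhds).comp_tendsto tendsto_sqrt_half_nhdsGT_zero).trans
      (isBigO_sqrt_half_pow_two_mul (N + 1))
  have hpow : (fun w : ℝ => w ^ (N + 1)) =O[𝓝[>] 0] fun w => w ^ N :=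
    (isLittleO_pow_pow N.lt_succ_self).isBigO.mono nhdsWithin_le_nhds
  refine ((isBigO_tsum_neg_one_pow_mul_exp_sub 1 N).add (hself.trans hpow)).congr_left fun w => ?_
  rw [Function.comp_apply, hzero, Polynomial.eval_one, mul_one, two_mul √(w / 2),
    add_sub_cancel_right, sub_add_sub_cancel]

end Gaussian

section ThetaSeries

/-- The power series of `log ((1 + t) / (1 - t))`; its constant coefficient is `0 / 0 = 0`. -/
noncomputable def logCayleySeries : ℝ⟦X⟧ := PowerSeries.mk fun n => (1 - (-1) ^ n) / n

theorem coeff_logCayleySeries_nonneg (n : ℕ) : 0 ≤ logCayleySeries.coeff n := by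
  rw [logCayleySeries, PowerSeries.coeff_mk]
  rcases neg_one_pow_eq_or ℝ n with h | h <;> rw [h]
  · simp
  · positivity

theorem constantCoeff_logCayleySeries : logCayleySeries.constantCoeff = 0 := by
  simp [logCayleySeries, ← PowerSeries.coeff_zero_eq_constantCoeff_apply]

theorem hasSeriesExpansion_logCayley :
    HasSeriesExpansion (fun t => Real.log ((1 + t) / (1 - t))) logCayleySeries := by
  refine .of_eventually_hasSum ?_
  filter_upwards [Ioo_mem_nhds (neg_lt_zero.2 one_pos) one_pos] with t ht
  have habs : |t| < 1 := abs_lt.2 ht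
  have hsum := (Real.hasSum_pow_div_log_of_abs_lt_one habs).sub
    (Real.hasSum_pow_div_log_of_abs_lt_one (x := -t) (by rwa [abs_neg]))
  have hlog : Real.log ((1 + t) / (1 - t)) -
      ∑ i ∈ Finset.range 1, logCayleySeries.coeff i * t ^ i =
      -Real.log (1 - t) - -Real.log (1 - -t) := by
    rw [Real.log_div (by linarith [ht.1]) (by linarith [ht.2]), Finset.sum_range_one,
      PowerSeries.coeff_zero_eq_constantCoeff_apply, constantCoeff_logCayleySeries]
    ring_nf
  rw [← hasSum_nat_add_iff' 1, hlog]
  refine hsum.congr_fun fun n => ?_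
  rw [logCayleySeries, PowerSeries.coeff_mk, neg_pow t, Nat.cast_succ]
  ring

theorem two_pow_le_coeff_logCayleySeries_pow (n : ℕ) :
    2 ^ n ≤ (logCayleySeries ^ n).coeff n := by
  induction n with
  | zero => simp
  | succ n ih =>
    have hone : logCayleySeries.coeff 1 = 2 := by norm_num [logCayleySeries]
    rw [pow_succ logCayleySeries, PowerSeries.coeff_mul]
    calc (2 : ℝ) ^ (n + 1) ≤ (logCayleySeries ^ n).coeff n * logCayleySeries.coeff 1 := by
          rw [hone, pow_succ]
          linarith
      _ ≤ _ := Finset.single_le_sum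
        (f := fun p : ℕ × ℕ => (logCayleySeries ^ n).coeff p.1 * logCayleySeries.coeff p.2)
        (fun i _ => mul_nonneg (coeff_pow_nonneg coeff_logCayleySeries_nonneg _ _)
          (coeff_logCayleySeries_nonneg _)) (by simp : ((n, 1) : ℕ × ℕ) ∈ _)

theorem HasSeriesExpansion.comp_logCayley {F : ℝ → ℝ} {c : ℝ⟦X⟧} (hF : HasSeriesExpansion F c) :
    HasSeriesExpansion (fun t => F (Real.log ((1 + t) / (1 - t)))) (c.subst logCayleySeries) := by
  refine hF.comp hasSeriesExpansion_logCayley constantCoeff_logCayleySeries ?_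
  filter_upwards [Ioo_mem_nhdsGT one_pos] with t ht
  exact Real.log_pos ((one_lt_div (by linarith [ht.2])).2 (by linarith [ht.1]))

/-- Complete the square `n² + b n = (n + b/2)² - b²/4` in the exponent of `q = exp (-w)`. -/
theorem partialTheta_eq_exp_mul_tsum (b : ℕ) {t : ℝ} (h0 : 0 < t) (h1 : t < 1) :
    partialTheta b t = Real.exp (Real.log ((1 + t) / (1 - t)) * (b ^ 2 / 4)) *
      (2 * ∑' n : ℕ, (-1) ^ n *
        Real.exp (-Real.log ((1 + t) / (1 - t)) * (n + (b / 2 : ℝ)) ^ 2)) := by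
  have hq : (1 - t) / (1 + t) = Real.exp (-Real.log ((1 + t) / (1 - t))) := by
    rw [Real.exp_neg, Real.exp_log (div_pos (by linarith) (by linarith)), inv_div]
  rw [partialTheta, hq]
  set w := Real.log ((1 + t) / (1 - t))
  rw [mul_left_comm, ← tsum_mul_left (a := Real.exp (w * (b ^ 2 / 4)))]
  congr 1
  refine tsum_congr fun n => ?_
  rw [mul_left_comm, ← Real.exp_add, ← Real.exp_nat_mul]
  congr 2
  push_cast
  ring

/-- The power series of `exp (w / 4)`. -/
noncomputable def expQuarterSeries : ℝ⟦X⟧ := PowerSeries.rescale (1 / 4) (PowerSeries.exp ℝ)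

theorem coeff_expQuarterSeries (n : ℕ) :
    expQuarterSeries.coeff n = (1 / 4) ^ n / (n ! : ℝ) := by
  simp [expQuarterSeries, div_eq_mul_inv]

theorem hasSeriesExpansion_expQuarter :
    HasSeriesExpansion (fun w => Real.exp (w * (1 / 4))) expQuarterSeries := by
  refine .of_eventually_hasSum (Eventually.of_forall fun w => ?_)
  have hsum := NormedSpace.expSeries_div_hasSum_exp (w * (1 / 4))
  rw [← Real.exp_eq_exp_ℝ] at hsum
  refine hsum.congr_fun fun n => ?_
  rw [coeff_expQuarterSeries, mul_pow]
  ring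

theorem factorial_le_doubleFactorial_two_mul_sub_one (k : ℕ) : k ! ≤ (2 * k - 1)‼ := by
  induction k with
  | zero => simp
  | succ k ih =>
    rcases k.eq_zero_or_pos with rfl | hk
    · simp
    · rw [show 2 * (k + 1) - 1 = 2 * k - 1 + 2 by omega, Nat.doubleFactorial_add_two,
        Nat.factorial_succ]
      exact Nat.mul_le_mul (by omega) ih

theorem pow_mul_factorial_le_coeff_alternatingGaussSeries (n : ℕ) :
    (1 / 8) ^ n * (n ! : ℝ) ≤ alternatingGaussSeries.coeff n := by
  have hsech := one_fourth_pow_le_neg_one_pow_mul_coeff_sechSqrtSeries n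
  have hfactorial : (n ! : ℝ) ≤ ((2 * n - 1)‼ : ℝ) := by
    exact_mod_cast factorial_le_doubleFactorial_two_mul_sub_one n
  rw [alternatingGaussSeries, PowerSeries.coeff_mk]
  calc (1 / 8) ^ n * (n ! : ℝ) = (1 / 4) ^ n * (n ! : ℝ) / 2 ^ n := by
        rw [show (1 / 8 : ℝ) = 1 / 4 * (1 / 2) by norm_num, mul_pow, one_div_pow 2]
        ring
    _ ≤ (-1) ^ n * sechSqrtSeries.coeff n * (2 * n - 1)‼ / 2 ^ n := by
        gcongr
        exact (by positivity : (0 : ℝ) ≤ (1 / 4) ^ n).trans hsech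

/-- The asymptotic expansion of `partialTheta 1`. -/
noncomputable def thetaOneSeries : ℝ⟦X⟧ :=
  (expQuarterSeries * alternatingGaussSeries).subst logCayleySeries

theorem hasSeriesExpansion_partialTheta_one :
    HasSeriesExpansion (partialTheta 1) thetaOneSeries := by
  refine (hasSeriesExpansion_expQuarter.mul
    hasSeriesExpansion_alternatingGauss).comp_logCayley.congr' ?_
  filter_upwards [Ioo_mem_nhdsGT one_pos] with t ht
  rw [partialTheta_eq_exp_mul_tsum 1 ht.1 ht.2, Nat.cast_one, one_pow]

theorem hasSeriesExpansion_partialTheta_two :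
    HasSeriesExpansion (partialTheta 2) cayleySeries := by
  have htsum := hasSeriesExpansion_two_mul_tsum_succ.comp_logCayley
  rw [← PowerSeries.coe_substAlgHom (.of_constantCoeff_zero' constantCoeff_logCayleySeries),
    map_one] at htsum
  have hmul := hasSeriesExpansion_cayley.mul htsum
  rw [mul_one] at hmul
  refine hmul.congr' ?_
  filter_upwards [Ioo_mem_nhdsGT one_pos] with t ht
  have hw : Real.log ((1 + t) / (1 - t)) * ((2 : ℕ) ^ 2 / 4) = Real.log ((1 + t) / (1 - t)) := by
    norm_num
  rw [partialTheta_eq_exp_mul_tsum 2 ht.1 ht.2, hw,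
    Real.exp_log (div_pos (by linarith [ht.1]) (by linarith [ht.2])), Nat.cast_two,
    div_self two_ne_zero]

theorem pow_mul_factorial_le_coeff_thetaOneSeries (n : ℕ) :
    (1 / 4) ^ n * (n ! : ℝ) ≤ thetaOneSeries.coeff n := by
  have hexp (n : ℕ) : 0 ≤ expQuarterSeries.coeff n := by
    rw [coeff_expQuarterSeries]
    positivity
  have hgauss (n : ℕ) : 0 ≤ alternatingGaussSeries.coeff n :=
    (by positivity : (0 : ℝ) ≤ (1 / 8) ^ n * (n ! : ℝ)).trans
      (pow_mul_factorial_le_coeff_alternatingGaussSeries n)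
  have hprod := coeff_mul_nonneg hexp hgauss
  calc (1 / 4) ^ n * (n ! : ℝ) = (1 / 8) ^ n * (n ! : ℝ) * 2 ^ n := by
        rw [show (1 / 4 : ℝ) = 1 / 8 * 2 by norm_num, mul_pow]
        ring
    _ ≤ (expQuarterSeries * alternatingGaussSeries).coeff n * (logCayleySeries ^ n).coeff n :=
        mul_le_mul ((pow_mul_factorial_le_coeff_alternatingGaussSeries n).trans
          (coeff_le_coeff_mul hexp (by simp [coeff_expQuarterSeries]) hgauss n))
          (two_pow_le_coeff_logCayleySeries_pow n) (by positivity) (hprod n)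
    _ ≤ thetaOneSeries.coeff n :=
        coeff_mul_coeff_pow_le_coeff_subst constantCoeff_logCayleySeries hprod
          coeff_logCayleySeries_nonneg n n

end ThetaSeries

section Recurrence

theorem partialTheta_add_two (b : ℕ) {t : ℝ} (h0 : 0 < t) (h1 : t < 1) :
    partialTheta (b + 2) t = ((1 + t) / (1 - t)) ^ (b + 1) * (2 - partialTheta b t) := by
  have hinv : (1 + t) / (1 - t) = ((1 - t) / (1 + t))⁻¹ := (inv_div _ _).symm
  rw [partialTheta, partialTheta, (summable_partialTheta b h0 h1).tsum_eq_zero_add, hinv]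
  have hq : (1 - t) / (1 + t) ≠ 0 := (div_pos (by linarith) (by linarith)).ne'
  generalize (1 - t) / (1 + t) = q at hq ⊢
  have hshift (n : ℕ) : (-1) ^ (n + 1) * q ^ ((n + 1) ^ 2 + b * (n + 1)) =
      -q ^ (b + 1) * ((-1) ^ n * q ^ (n ^ 2 + (b + 2) * n)) := by
    rw [show (n + 1) ^ 2 + b * (n + 1) = b + 1 + (n ^ 2 + (b + 2) * n) by ring, pow_add q]
    ring
  rw [tsum_congr hshift, tsum_mul_left, inv_pow]
  simp only [pow_zero, mul_zero, add_zero, mul_one, zero_pow two_ne_zero]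
  field_simp
  ring

theorem HasSeriesExpansion.partialTheta_add_two {b : ℕ} {P : ℝ⟦X⟧}
    (h : HasSeriesExpansion (partialTheta b) P) :
    HasSeriesExpansion (partialTheta (b + 2))
      (cayleySeries ^ (b + 1) * (PowerSeries.C 2 - P)) := by
  have hpow : HasSeriesExpansion (fun t => ((1 + t) / (1 - t)) ^ (b + 1))
      (cayleySeries ^ (b + 1)) := by
    simpa using hasSeriesExpansion_cayley.aeval (Polynomial.X ^ (b + 1))
  refine (hpow.mul ((HasSeriesExpansion.const 2).sub h)).congr' ?_
  filter_upwards [Ioo_mem_nhdsGT one_pos] with t ht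
  rw [_root_.partialTheta_add_two b ht.1 ht.2]

/-- Multiplying by powers of `cayleySeries` turns `P` into something larger than any multiple of
that power. This strengthening of eventual positivity survives the recurrence in `b`. -/
def DominatesCayley (P : ℝ⟦X⟧) : Prop :=
  ∀ (c : ℝ) (k : ℕ), ∀ᶠ n in atTop,
    c * (cayleySeries ^ k).coeff n < (cayleySeries ^ k * P).coeff n

theorem DominatesCayley.eventually_coeff_pos {P : ℝ⟦X⟧} (hP : DominatesCayley P) :
    ∀ᶠ n in atTop, 0 < P.coeff n := by
  simpa using hP 0 0

theorem DominatesCayley.cayleySeries_pow_mul_add_C {P : ℝ⟦X⟧} (hP : DominatesCayley P) (l : ℕ)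
    (a : ℝ) : DominatesCayley (cayleySeries ^ l * (P + PowerSeries.C a)) := fun c k => by
  filter_upwards [hP (|c| - a) (k + l)] with n hn
  have hc : c * (cayleySeries ^ k).coeff n ≤ |c| * (cayleySeries ^ (k + l)).coeff n :=
    mul_le_mul (le_abs_self c) (coeff_cayleySeries_pow_le_coeff_pow_add k l n)
      (coeff_cayleySeries_pow_nonneg k n) (abs_nonneg c)
  rw [← mul_assoc, ← pow_add, mul_add, map_add, PowerSeries.coeff_mul_C]
  linarith

theorem DominatesCayley.of_pow_mul_factorial_le {P : ℝ⟦X⟧} {r : ℝ} (hr : 0 < r)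
    (hP : ∀ n : ℕ, r ^ n * (n ! : ℝ) ≤ P.coeff n) : DominatesCayley P := fun c k => by
  have hlim := (FloorSemiring.tendsto_pow_div_factorial_atTop (k * 2 / r)).const_mul |c|
  rw [mul_zero] at hlim
  filter_upwards [hlim.eventually (gt_mem_nhds one_pos)] with n hn
  rw [← mul_div_assoc, div_lt_one (by positivity), div_pow, ← mul_div_assoc,
    div_lt_iff₀ (by positivity)] at hn
  have hP0 (n : ℕ) : 0 ≤ P.coeff n := (by positivity : 0 ≤ r ^ n * (n ! : ℝ)).trans (hP n)
  calc c * (cayleySeries ^ k).coeff n ≤ |c| * (k * 2) ^ n :=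
        mul_le_mul (le_abs_self c) (coeff_cayleySeries_pow_le k n)
          (coeff_cayleySeries_pow_nonneg k n) (abs_nonneg c)
    _ < n ! * r ^ n := hn
    _ = r ^ n * n ! := mul_comm _ _
    _ ≤ P.coeff n := hP n
    _ ≤ (cayleySeries ^ k * P).coeff n := coeff_le_coeff_cayleySeries_pow_mul hP0 k n

theorem dominatesCayley_thetaOneSeries : DominatesCayley thetaOneSeries :=
  .of_pow_mul_factorial_le (by norm_num) pow_mul_factorial_le_coeff_thetaOneSeries

theorem dominatesCayley_cayleySeries : DominatesCayley cayleySeries := fun c k => by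
  simpa only [pow_succ] using eventually_mul_coeff_cayleySeries_pow_lt c k

theorem DominatesCayley.exists_partialTheta_add_two_mul {b : ℕ} {P : ℝ⟦X⟧}
    (hP : DominatesCayley P) (h : HasSeriesExpansion (partialTheta b) P) (m : ℕ) :
    ∃ Q, DominatesCayley Q ∧
      HasSeriesExpansion (partialTheta (b + 2 * m)) (PowerSeries.C ((-1) ^ m) * Q) := by
  induction m with
  | zero => exact ⟨P, hP, by simpa using h⟩
  | succ m ih =>
    obtain ⟨Q, hQ, hm⟩ := ih
    refine ⟨_, hQ.cayleySeries_pow_mul_add_C (b + 2 * m + 1) (-2 * (-1) ^ m), ?_⟩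
    have hsign : (PowerSeries.C ((-1) ^ m) : ℝ⟦X⟧) * PowerSeries.C ((-1) ^ m) = 1 := by
      rw [← map_mul, ← mul_pow, neg_one_mul, neg_neg, one_pow, map_one]
    have hseries : PowerSeries.C ((-1) ^ (m + 1)) *
        (cayleySeries ^ (b + 2 * m + 1) * (Q + PowerSeries.C (-2 * (-1) ^ m))) =
        cayleySeries ^ (b + 2 * m + 1) * (PowerSeries.C 2 - PowerSeries.C ((-1) ^ m) * Q) := by
      simp only [pow_succ (-1 : ℝ) m, map_mul, map_neg, map_one]
      linear_combination PowerSeries.C 2 * cayleySeries ^ (b + 2 * m + 1) * hsign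
    rw [hseries]
    exact hm.partialTheta_add_two

theorem exists_hasSeriesExpansion_partialTheta {b : ℕ} (hb : 0 < b) :
    ∃ Q : ℝ⟦X⟧, (∀ᶠ n in atTop, 0 < Q.coeff n) ∧
      HasSeriesExpansion (partialTheta b) (PowerSeries.C ((-1) ^ ((b - 1) / 2)) * Q) := by
  obtain ⟨P, hP, h⟩ : ∃ P, DominatesCayley P ∧
      HasSeriesExpansion (partialTheta (b - 2 * ((b - 1) / 2))) P := by
    obtain hodd | heven : b - 2 * ((b - 1) / 2) = 1 ∨ b - 2 * ((b - 1) / 2) = 2 := by omega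
    · rw [hodd]
      exact ⟨_, dominatesCayley_thetaOneSeries, hasSeriesExpansion_partialTheta_one⟩
    · rw [heven]
      exact ⟨_, dominatesCayley_cayleySeries, hasSeriesExpansion_partialTheta_two⟩
  obtain ⟨Q, hQ, hm⟩ := hP.exists_partialTheta_add_two_mul h ((b - 1) / 2)
  rw [Nat.sub_add_cancel (by omega)] at hm
  exact ⟨Q, hQ.eventually_coeff_pos, hm⟩

end Recurrence

theorem theorem1 (b : ℕ) (hb : 0 < b) :
    (∃! a : ℕ → ℝ, HasAsymptoticExpansion (partialTheta b) a) ∧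
    ∀ a : ℕ → ℝ, HasAsymptoticExpansion (partialTheta b) a →
      ((∀ᶠ n in atTop, 0 < a n) ∨ (∀ᶠ n in atTop, a n < 0)) ∧
      ((b ≡ 1 [MOD 4] ∨ b ≡ 2 [MOD 4]) → ∀ᶠ n in atTop, 0 < a n) ∧
      ((b ≡ 0 [MOD 4] ∨ b ≡ 3 [MOD 4]) → ∀ᶠ n in atTop, a n < 0) := by
  obtain ⟨Q, hQ, hexp⟩ := exists_hasSeriesExpansion_partialTheta hb
  have hA := hasAsymptoticExpansion_iff.2 hexp
  refine ⟨⟨_, hA, fun a ha => ha.unique hA⟩, fun a ha => ?_⟩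
  obtain rfl := ha.unique hA
  simp only [PowerSeries.coeff_C_mul, Nat.ModEq]
  obtain heven | hodd := Nat.even_or_odd ((b - 1) / 2)
  · simp only [heven.neg_one_pow, one_mul]
    exact ⟨.inl hQ, fun _ => hQ, fun h => by grind⟩
  · simp only [hodd.neg_one_pow, neg_one_mul, neg_lt_zero]
    exact ⟨.inr hQ, fun h => by grind, fun _ => hQ⟩
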